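/- For a bounded set $E\subseteq\mathbb R$ and $r>0$, let $N(E,r)$ be the least number of closed balls of radius $r$ (that is, closed intervals of length $2r$) needed to cover $E$, and let $$\overline{\dim}_M E=\limsup_{r\downarrow 0}\frac{\log N(E,r)}{\log(1/r)}\qquad(\log 0:=-\infty)$$ be the upper Minkowski dimension of $E$. For $A\subseteq\mathbb R$, put $$Q(A)=\Big\{\frac{a-b}{c-d} : a,b,c,d\in A,\ c\neq d\Big\}.$$ Lemma. Let $E\subseteq\mathbb R$ be bounded with $\overline{\dim}_M E>0$. Then there exist $n\in\mathbb N$ and a linear map $T\colon\mathbb R^n\to\mathbb R$ such that $Q(T(E^n))$ is dense in $\mathbb R$. -/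

import Mathlib

open Filter Topology
open scoped NNReal ENNReal

/-- The upper Minkowski (box-counting) dimension of a set `E` in a metric space:
`limsup_{r ↓ 0} log N(E, r) / log (1 / r)`, where `N(E, r)` is the least number of closed balls of
radius `r` (centred anywhere in the space) that cover `E`. It takes values in `[-∞, ∞]`, and
`ENNReal.log 0 = -∞`. -/
noncomputable def upperMinkowskiDim {X : Type*} [PseudoEMetricSpace X] (E : Set X) : EReal :=
  limsup
    (fun r : ℝ≥0 =>
      ENNReal.log ((Metric.externalCoveringNumber r E : ℕ∞) : ℝ≥0∞) /
        ((Real.log (1 / (r : ℝ)) : ℝ) : EReal))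
    (𝓝[>] 0)

/-- The quotient set `Q(E) = {(a - b) / (c - d) : a, b, c, d ∈ E, c ≠ d}`. -/
def quotientSet (E : Set ℝ) : Set ℝ :=
  {x | ∃ a ∈ E, ∃ b ∈ E, ∃ c ∈ E, ∃ d ∈ E, c ≠ d ∧ x = (a - b) / (c - d)}

/-!
If `Q(A)` misses an `ε`-neighbourhood of `x`, then `|(a - b) - x (c - d)| ≥ ε |c - d|` on `A`, so
`(a, c) ↦ a - x c` is antilipschitz on `A × A`. Hence, if no `Q(T(E^n))` were dense, starting from
the identity on `E` one would obtain, for arbitrarily large `n`, a linear map `T : ℝ^n → ℝ` that is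
antilipschitz on `E^n`. Antilipschitz maps do not lower the upper Minkowski dimension, so
`n * dim E ≤ dim E^n ≤ dim T(E^n) ≤ 1`, which is impossible for large `n` when `dim E > 0`.
-/

section PackingNumber

open Metric MeasureTheory

variable {X Y : Type*}

theorem packingNumber_anti [PseudoEMetricSpace X] {δ ε : ℝ≥0} (h : δ ≤ ε) (A : Set X) :
    packingNumber ε A ≤ packingNumber δ A :=
  iSup₂_mono fun _ _ => iSup_mono' fun hC => ⟨hC.anti (by exact_mod_cast h), le_rfl⟩

theorem packingNumber_mul_le_image_of_antilipschitzWith [PseudoEMetricSpace X]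
    [PseudoEMetricSpace Y] {f : X → Y} {A : Set X} {K : ℝ≥0}
    (hf : AntilipschitzWith K (A.domRestrict f)) (ε : ℝ≥0) :
    packingNumber (K * ε) A ≤ packingNumber ε (f '' A) := by
  refine iSup₂_le fun C hCA => iSup_le fun hC => ?_
  have hsep : ∀ ⦃x⦄, x ∈ C → ∀ ⦃y⦄, y ∈ C → x ≠ y → (ε : ℝ≥0∞) < edist (f x) (f y) := by
    intro x hx y hy hxy
    have hlt : (K : ℝ≥0∞) * ε < K * edist (f x) (f y) := by
      rw [← ENNReal.coe_mul]
      exact (hC hx hy hxy).trans_le (hf ⟨x, hCA hx⟩ ⟨y, hCA hy⟩)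
    exact lt_of_mul_lt_mul_left' hlt
  have hinj : Set.InjOn f C := by
    intro x hx y hy hxy
    by_contra hne
    simpa [hxy] using hsep hx hy hne
  have himage : IsSeparated ε (f '' C) := by
    rintro _ ⟨x, hx, rfl⟩ _ ⟨y, hy, rfl⟩ hne
    exact hsep hx hy fun h => hne (congrArg f h)
  rw [← hinj.encard_image]
  exact himage.encard_le_packingNumber (Set.image_mono hCA)

theorem isSeparated_pi {ι : Type*} [Fintype ι] {X : ι → Type*} [∀ i, PseudoEMetricSpace (X i)]
    {ε : ℝ≥0∞} {C : ∀ i, Set (X i)} (hC : ∀ i, IsSeparated ε (C i)) :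
    IsSeparated ε (Set.univ.pi C) := by
  intro x hx y hy hxy
  obtain ⟨i, hi⟩ := Function.ne_iff.1 hxy
  exact (hC i (hx i trivial) (hy i trivial) hi).trans_le (edist_le_pi_edist x y i)

theorem packingNumber_pow_card_le_pi [PseudoEMetricSpace X] {ι : Type*} [Fintype ι]
    [Nonempty ι] (ε : ℝ≥0) (A : Set X) :
    packingNumber ε A ^ Fintype.card ι ≤ packingNumber ε (Set.univ.pi fun _ : ι => A) := by
  rw [← ENat.toENNReal_le, ENat.toENNReal_pow]
  conv_lhs => rw [packingNumber]
  simp only [ENat.toENNReal_iSup, ENNReal.iSup_pow_of_ne_zero Fintype.card_ne_zero]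
  refine iSup₂_le fun C hCA => iSup_le fun hC => ?_
  rw [← ENat.toENNReal_pow, ENat.toENNReal_le]
  calc C.encard ^ Fintype.card ι = (Set.univ.pi fun _ : ι => C).encard := by simp
    _ ≤ packingNumber ε (Set.univ.pi fun _ : ι => A) :=
      (isSeparated_pi fun _ => hC).encard_le_packingNumber (Set.pi_mono fun _ _ => hCA)

theorem packingNumber_mul_le_measure_thickening [PseudoMetricSpace X] [MeasurableSpace X]
    [OpensMeasurableSpace X] (μ : Measure X) {A : Set X} {ε : ℝ≥0} {m : ℝ≥0∞}
    (hm : ∀ x ∈ A, m ≤ μ (ball x (ε / 2))) :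
    packingNumber ε A * m ≤ μ (thickening (ε / 2) A) := by
  simp only [packingNumber, ENat.toENNReal_iSup, ENNReal.iSup_mul]
  refine iSup₂_le fun C hCA => iSup_le fun hC => ?_
  have hdisj : Pairwise (Function.onFun Disjoint fun x : C => ball (x : X) (ε / 2)) := by
    intro x y hxy
    have hlt : (ε : ℝ≥0∞) < edist (x : X) y := hC x.2 y.2 (Subtype.coe_injective.ne hxy)
    rw [edist_nndist, ENNReal.coe_lt_coe] at hlt
    refine ball_disjoint_ball ?_
    rw [add_halves]
    exact_mod_cast hlt.le
  calc (C.encard : ℝ≥0∞) * m = ∑' _ : C, m := (ENNReal.tsum_set_const C m).symm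
    _ ≤ ∑' x : C, μ (ball (x : X) (ε / 2)) := ENNReal.tsum_le_tsum fun x => hm x (hCA x.2)
    _ ≤ μ (⋃ x : C, ball (x : X) (ε / 2)) :=
      tsum_meas_le_meas_iUnion_of_disjoint μ (fun _ => measurableSet_ball) hdisj
    _ ≤ μ (thickening (ε / 2) A) :=
      measure_mono (Set.iUnion_subset fun x => ball_subset_thickening (hCA x.2) _)

end PackingNumber

section UpperMinkowskiDim

open Metric MeasureTheory

variable {X Y : Type*}

theorem log_div_log_one_div_le_iff {r : ℝ≥0} (h0 : 0 < r) (h1 : r < 1) (N : ℝ≥0∞) (s : ℝ) :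
    ENNReal.log N / (Real.log (1 / (r : ℝ)) : EReal) ≤ s ↔ N ≤ (r : ℝ≥0∞) ^ (-s) := by
  have hlog : 0 < Real.log (1 / (r : ℝ)) :=
    Real.log_pos ((one_lt_div (by exact_mod_cast h0)).2 (by exact_mod_cast h1))
  rw [EReal.div_le_iff_le_mul (by exact_mod_cast hlog) (EReal.coe_ne_top _),
    ← ENNReal.log_le_log_iff, ENNReal.log_rpow, ENNReal.log_of_nnreal h0.ne', ← EReal.coe_mul,
    ← EReal.coe_mul, one_div, Real.log_inv, neg_mul_comm, mul_comm]

theorem upperMinkowskiDim_le_of_eventually_externalCoveringNumber_le [PseudoEMetricSpace X]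
    {A : Set X} {s : ℝ}
    (h : ∀ᶠ r : ℝ≥0 in 𝓝[>] 0, (externalCoveringNumber r A : ℝ≥0∞) ≤ (r : ℝ≥0∞) ^ (-s)) :
    upperMinkowskiDim A ≤ s := by
  refine limsup_le_of_le (by isBoundedDefault) ?_
  filter_upwards [h, Ioo_mem_nhdsGT one_pos] with r hr hr01
  exact (log_div_log_one_div_le_iff hr01.1 hr01.2 _ s).2 hr

theorem eventually_externalCoveringNumber_le_of_upperMinkowskiDim_lt [PseudoEMetricSpace X]
    {A : Set X} {s : ℝ} (h : upperMinkowskiDim A < s) :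
    ∀ᶠ r : ℝ≥0 in 𝓝[>] 0, (externalCoveringNumber r A : ℝ≥0∞) ≤ (r : ℝ≥0∞) ^ (-s) := by
  filter_upwards [eventually_lt_of_limsup_lt h, Ioo_mem_nhdsGT one_pos] with r hr hr01
  exact (log_div_log_one_div_le_iff hr01.1 hr01.2 _ s).1 hr.le

theorem eventually_packingNumber_two_mul_le_of_upperMinkowskiDim_lt [PseudoEMetricSpace X]
    {A : Set X} {s : ℝ} (h : upperMinkowskiDim A < s) :
    ∀ᶠ r : ℝ≥0 in 𝓝[>] 0, (packingNumber (2 * r) A : ℝ≥0∞) ≤ (r : ℝ≥0∞) ^ (-s) := by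
  filter_upwards [eventually_externalCoveringNumber_le_of_upperMinkowskiDim_lt h] with r hr
  exact (ENat.toENNReal_le.2 (packingNumber_two_mul_le_externalCoveringNumber r A)).trans hr

theorem eventually_const_mul_div_rpow_neg_le {C : ℝ≥0∞} (hC : C ≠ ∞) {c : ℝ≥0} (hc : c ≠ 0)
    {s t : ℝ} (hst : s < t) :
    ∀ᶠ r : ℝ≥0 in 𝓝[>] 0, C * ((r / c : ℝ≥0) : ℝ≥0∞) ^ (-s) ≤ (r : ℝ≥0∞) ^ (-t) := by
  have hlim : Tendsto (fun r : ℝ≥0 => (r : ℝ≥0∞) ^ (s - t)) (𝓝[>] 0) (𝓝 ∞) := by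
    have hcont : Continuous fun r : ℝ≥0 => (r : ℝ≥0∞) ^ (s - t) :=
      ENNReal.continuous_rpow_const.comp ENNReal.continuous_coe
    simpa [ENNReal.zero_rpow_of_neg (sub_neg.2 hst)] using
      (hcont.tendsto 0).mono_left nhdsWithin_le_nhds
  have hlt : C * (c : ℝ≥0∞) ^ s < ∞ :=
    (ENNReal.mul_ne_top hC
      (ENNReal.rpow_ne_top_of_ne_zero (by exact_mod_cast hc) ENNReal.coe_ne_top)).lt_top
  filter_upwards [hlim.eventually_const_le hlt, self_mem_nhdsWithin] with r hr hr0
  have hr0' : (r : ℝ≥0∞) ≠ 0 := by exact_mod_cast hr0.ne'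
  have hc' : (c : ℝ≥0∞)⁻¹ ≠ 0 := by simp
  calc C * ((r / c : ℝ≥0) : ℝ≥0∞) ^ (-s) = C * (c : ℝ≥0∞) ^ s * (r : ℝ≥0∞) ^ (-s) := by
        rw [ENNReal.coe_div hc, div_eq_mul_inv, ENNReal.mul_rpow_of_ne_zero hr0' hc',
          ENNReal.inv_rpow, ENNReal.rpow_neg (c : ℝ≥0∞), inv_inv, mul_assoc, mul_comm (_ ^ (-s))]
    _ ≤ (r : ℝ≥0∞) ^ (s - t) * (r : ℝ≥0∞) ^ (-s) := by gcongr
    _ = (r : ℝ≥0∞) ^ (-t) := by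
        rw [← ENNReal.rpow_add _ _ hr0' ENNReal.coe_ne_top]
        congr 1
        ring

theorem upperMinkowskiDim_le_of_eventually_packingNumber_le [PseudoEMetricSpace X] {A : Set X}
    {c : ℝ≥0} {C : ℝ≥0∞} (hC : C ≠ ∞) {s : ℝ}
    (h : ∀ᶠ r : ℝ≥0 in 𝓝[>] 0, (packingNumber (c * r) A : ℝ≥0∞) ≤ C * (r : ℝ≥0∞) ^ (-s)) :
    upperMinkowskiDim A ≤ s := by
  refine EReal.le_of_forall_lt_iff_le.1 fun t hst => ?_
  rw [EReal.coe_lt_coe_iff] at hst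
  have hc : 0 < c + 1 := by positivity
  have hscale : Tendsto (fun r : ℝ≥0 => r / (c + 1)) (𝓝[>] 0) (𝓝[>] 0) := by
    refine tendsto_nhdsWithin_iff.2 ⟨?_, ?_⟩
    · exact ((continuous_id.div_const (c + 1)).tendsto' 0 0 (zero_div _)).mono_left
        nhdsWithin_le_nhds
    · filter_upwards [self_mem_nhdsWithin] with r hr using div_pos hr hc
  refine upperMinkowskiDim_le_of_eventually_externalCoveringNumber_le ?_
  filter_upwards [hscale.eventually h, eventually_const_mul_div_rpow_neg_le hC hc.ne' hst]
    with r hpack hrpow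
  have hle : c * (r / (c + 1)) ≤ r := by
    calc c * (r / (c + 1)) ≤ (c + 1) * (r / (c + 1)) := by gcongr; exact le_self_add
      _ = r := mul_div_cancel₀ r hc.ne'
  have hcover : externalCoveringNumber r A ≤ packingNumber (c * (r / (c + 1))) A :=
    calc externalCoveringNumber r A ≤ coveringNumber r A :=
        externalCoveringNumber_le_coveringNumber r A
      _ ≤ packingNumber r A := coveringNumber_le_packingNumber r A
      _ ≤ packingNumber (c * (r / (c + 1))) A := packingNumber_anti hle A
  exact ((ENat.toENNReal_le.2 hcover).trans hpack).trans hrpow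

theorem upperMinkowskiDim_le_image_of_antilipschitzWith [PseudoEMetricSpace X]
    [PseudoEMetricSpace Y] {f : X → Y} {A : Set X} {K : ℝ≥0}
    (hf : AntilipschitzWith K (A.domRestrict f)) :
    upperMinkowskiDim A ≤ upperMinkowskiDim (f '' A) := by
  refine EReal.le_of_forall_lt_iff_le.1 fun s hs => ?_
  refine upperMinkowskiDim_le_of_eventually_packingNumber_le (c := K * 2) ENNReal.one_ne_top ?_
  filter_upwards [eventually_packingNumber_two_mul_le_of_upperMinkowskiDim_lt hs] with r hr
  rw [one_mul, mul_assoc]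
  exact (ENat.toENNReal_le.2 (packingNumber_mul_le_image_of_antilipschitzWith hf _)).trans hr

theorem card_mul_upperMinkowskiDim_le_pi [PseudoEMetricSpace X] {ι : Type*}
    [Fintype ι] [Nonempty ι] (A : Set X) :
    Fintype.card ι * upperMinkowskiDim A ≤ upperMinkowskiDim (Set.univ.pi fun _ : ι => A) := by
  refine EReal.le_of_forall_lt_iff_le.1 fun s hs => ?_
  have hcard : (0 : ℝ) < Fintype.card ι := by exact_mod_cast Fintype.card_pos
  suffices h : upperMinkowskiDim A ≤ (s / Fintype.card ι : ℝ) by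
    rwa [EReal.coe_div, EReal.le_div_iff_mul_le (by exact_mod_cast hcard) (EReal.coe_ne_top _),
      mul_comm] at h
  refine upperMinkowskiDim_le_of_eventually_packingNumber_le (c := 2) ENNReal.one_ne_top ?_
  filter_upwards [eventually_packingNumber_two_mul_le_of_upperMinkowskiDim_lt hs] with r hr
  rw [one_mul, ← neg_div, div_eq_mul_inv, ENNReal.rpow_mul, ENNReal.le_rpow_inv_iff hcard,
    ENNReal.rpow_natCast, ← ENat.toENNReal_pow]
  exact (ENat.toENNReal_le.2 (packingNumber_pow_card_le_pi _ A)).trans hr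

theorem upperMinkowskiDim_le_finrank {V : Type*} [NormedAddCommGroup V] [NormedSpace ℝ V]
    [FiniteDimensional ℝ V] {A : Set V} (hA : Bornology.IsBounded A) :
    upperMinkowskiDim A ≤ Module.finrank ℝ V := by
  borelize V
  let μ : Measure V := Measure.addHaar
  let d := Module.finrank ℝ V
  have hball0 : μ (ball 0 1) ≠ 0 := (measure_ball_pos μ 0 one_pos).ne'
  have hC : μ (thickening 1 A) / μ (ball 0 1) ≠ ∞ :=
    ENNReal.div_ne_top hA.thickening.measure_lt_top.ne hball0
  refine upperMinkowskiDim_le_of_eventually_packingNumber_le (s := d) (c := 2) hC ?_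
  filter_upwards [Ioo_mem_nhdsGT one_pos] with r ⟨hr0, hr1⟩
  have hr0' : (r : ℝ≥0∞) ≠ 0 := by exact_mod_cast hr0.ne'
  have hball : ∀ x, μ (ball x r) = (r : ℝ≥0∞) ^ d * μ (ball 0 1) := fun x => by
    rw [Measure.addHaar_ball_of_pos μ x (by exact_mod_cast hr0), ENNReal.ofReal_pow r.coe_nonneg,
      ENNReal.ofReal_coe_nnreal]
  have hhalf : ((2 * r : ℝ≥0) : ℝ) / 2 = r := by push_cast; ring
  have hvol : packingNumber (2 * r) A * ((r : ℝ≥0∞) ^ d * μ (ball 0 1)) ≤ μ (thickening 1 A) := by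
    calc packingNumber (2 * r) A * ((r : ℝ≥0∞) ^ d * μ (ball 0 1))
        ≤ μ (thickening (((2 * r : ℝ≥0) : ℝ) / 2) A) :=
          packingNumber_mul_le_measure_thickening μ fun x _ => by rw [hhalf, hball]
      _ ≤ μ (thickening 1 A) := measure_mono (thickening_mono (by rw [hhalf]; exact hr1.le) A)
  rw [ENNReal.rpow_neg, ENNReal.rpow_natCast, ← div_eq_mul_inv, ENNReal.le_div_iff_mul_le,
    ENNReal.le_div_iff_mul_le, mul_assoc]
  · exact hvol
  all_goals simp [hball0, hr0', measure_ball_lt_top.ne]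

end UpperMinkowskiDim

section QuotientSet

theorem exists_forall_le_dist_of_not_dense {X : Type*} [PseudoMetricSpace X] {s : Set X}
    (hs : ¬ Dense s) : ∃ x, ∃ ε > 0, ∀ y ∈ s, ε ≤ dist y x := by
  simpa [Dense, Metric.mem_closure_iff, dist_comm] using hs

theorem mul_abs_sub_le_of_forall_quotientSet {A : Set ℝ} {x ε : ℝ}
    (hx : ∀ y ∈ quotientSet A, ε ≤ dist y x) {a b c d : ℝ} (ha : a ∈ A) (hb : b ∈ A) (hc : c ∈ A)
    (hd : d ∈ A) : ε * |c - d| ≤ |(a - x * c) - (b - x * d)| := by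
  rcases eq_or_ne c d with rfl | hne
  · simp
  have hcd : c - d ≠ 0 := sub_ne_zero.2 hne
  calc ε * |c - d| ≤ |(a - b) / (c - d) - x| * |c - d| := by
        gcongr
        exact hx _ ⟨a, ha, b, hb, c, hc, d, hd, hne, rfl⟩
    _ = |(a - x * c) - (b - x * d)| := by
        rw [← abs_mul]
        congr 1
        field_simp
        ring

theorem exists_antilipschitzWith_sub_mul_of_not_dense_quotientSet {A : Set ℝ}
    (hA : ¬ Dense (quotientSet A)) :
    ∃ (x : ℝ) (K : ℝ≥0),
      AntilipschitzWith K ((A ×ˢ A).domRestrict fun p : ℝ × ℝ => p.1 - x * p.2) := by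
  obtain ⟨x, ε, hε, hx⟩ := exists_forall_le_dist_of_not_dense hA
  have hK : 0 ≤ 1 + (1 + |x|) / ε := by positivity
  refine ⟨x, ⟨1 + (1 + |x|) / ε, hK⟩, AntilipschitzWith.of_le_mul_dist ?_⟩
  rintro ⟨⟨a, c⟩, ha, hc⟩ ⟨⟨b, d⟩, hb, hd⟩
  simp only [Subtype.dist_eq, Prod.dist_eq, Set.domRestrict_apply, Real.dist_eq]
  set D := |(a - x * c) - (b - x * d)|
  have hcd : |c - d| ≤ D / ε := by
    rw [le_div_iff₀' hε]
    exact mul_abs_sub_le_of_forall_quotientSet hx ha hb hc hd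
  have hab : |a - b| ≤ D + |x| * (D / ε) := by
    calc |a - b| = |((a - x * c) - (b - x * d)) + x * (c - d)| := by congr 1; ring
      _ ≤ D + |x * (c - d)| := abs_add_le _ _
      _ = D + |x| * |c - d| := by rw [abs_mul]
      _ ≤ D + |x| * (D / ε) := by gcongr
  have hD : 0 ≤ D := abs_nonneg _
  have hDε : 0 ≤ D / ε := by positivity
  have hxD : 0 ≤ |x| * (D / ε) := by positivity
  calc max |a - b| |c - d| ≤ D + (1 + |x|) * (D / ε) := max_le (by linarith) (by linarith)
    _ = (1 + (1 + |x|) / ε) * D := by ring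

theorem exists_linearMap_antilipschitzWith_add_self {X : Type*} [AddCommGroup X] [Module ℝ X]
    [PseudoEMetricSpace X] {E : Set X} {n : ℕ} {T : (Fin n → X) →ₗ[ℝ] ℝ} {K : ℝ≥0}
    (hT : AntilipschitzWith K ((Set.univ.pi fun _ => E).domRestrict T))
    (hQ : ¬ Dense (quotientSet (T '' Set.univ.pi fun _ => E))) :
    ∃ (T' : (Fin (n + n) → X) →ₗ[ℝ] ℝ) (K' : ℝ≥0),
      AntilipschitzWith K' ((Set.univ.pi fun _ => E).domRestrict T') := by
  obtain ⟨x, L, hL⟩ := exists_antilipschitzWith_sub_mul_of_not_dense_quotientSet hQ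
  let fst := LinearMap.funLeft ℝ X (Fin.castAdd n : Fin n → Fin (n + n))
  let snd := LinearMap.funLeft ℝ X (Fin.natAdd n : Fin n → Fin (n + n))
  refine ⟨T ∘ₗ fst - x • (T ∘ₗ snd), K * L, ?_⟩
  rintro ⟨u, hu⟩ ⟨v, hv⟩
  have hfst : ∀ w ∈ Set.univ.pi fun _ => E, fst w ∈ Set.univ.pi fun _ => E :=
    fun w hw i _ => hw (Fin.castAdd n i) trivial
  have hsnd : ∀ w ∈ Set.univ.pi fun _ => E, snd w ∈ Set.univ.pi fun _ => E :=
    fun w hw i _ => hw (Fin.natAdd n i) trivial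
  have hpair : ∀ w ∈ Set.univ.pi fun _ => E, (T (fst w), T (snd w)) ∈
      (T '' Set.univ.pi fun _ => E) ×ˢ (T '' Set.univ.pi fun _ => E) := fun w hw =>
    ⟨Set.mem_image_of_mem T (hfst w hw), Set.mem_image_of_mem T (hsnd w hw)⟩
  calc edist u v ≤ max (edist (fst u) (fst v)) (edist (snd u) (snd v)) :=
        edist_pi_le_iff.2 (Fin.addCases
          (fun i => (edist_le_pi_edist (fst u) (fst v) i).trans (le_max_left _ _))
          (fun i => (edist_le_pi_edist (snd u) (snd v) i).trans (le_max_right _ _)))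
    _ ≤ max (K * edist (T (fst u)) (T (fst v))) (K * edist (T (snd u)) (T (snd v))) :=
        max_le_max (hT ⟨_, hfst u hu⟩ ⟨_, hfst v hv⟩) (hT ⟨_, hsnd u hu⟩ ⟨_, hsnd v hv⟩)
    _ = K * edist (T (fst u), T (snd u)) (T (fst v), T (snd v)) := by
        rw [Prod.edist_eq, mul_max]
    _ ≤ K * (L * edist (T (fst u) - x * T (snd u)) (T (fst v) - x * T (snd v))) := by
        gcongr
        exact hL ⟨_, hpair u hu⟩ ⟨_, hpair v hv⟩
    _ = (K * L : ℝ≥0) * edist (T (fst u) - x * T (snd u)) (T (fst v) - x * T (snd v)) := by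
        rw [ENNReal.coe_mul, mul_assoc]

theorem exists_linearMap_antilipschitzWith_of_forall_not_dense {E : Set ℝ}
    (hQ : ∀ (n : ℕ) (T : (Fin n → ℝ) →ₗ[ℝ] ℝ),
      ¬ Dense (quotientSet (T '' Set.univ.pi fun _ => E))) (k : ℕ) :
    ∃ n > k, ∃ (T : (Fin n → ℝ) →ₗ[ℝ] ℝ) (K : ℝ≥0),
      AntilipschitzWith K ((Set.univ.pi fun _ => E).domRestrict T) := by
  induction k with
  | zero =>
    refine ⟨1, one_pos, LinearMap.proj 0, 1, ?_⟩
    exact (IsometryEquiv.funUnique (Fin 1) ℝ).isometry.antilipschitz.domRestrict _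
  | succ k ih =>
    obtain ⟨n, hkn, T, K, hT⟩ := ih
    exact ⟨n + n, by lia, exists_linearMap_antilipschitzWith_add_self hT (hQ n T)⟩

end QuotientSet

theorem exists_forall_gt_lt_natCast_mul {a : EReal} (ha : 0 < a) (b : ℝ) :
    ∃ k : ℕ, ∀ n > k, (b : EReal) < n * a := by
  obtain ⟨s, hs0, hsa⟩ := EReal.lt_iff_exists_real_btwn.1 ha
  have hs0 : 0 < s := by exact_mod_cast hs0
  obtain ⟨k, hk⟩ := exists_nat_gt (b / s)
  refine ⟨k, fun n hn => ?_⟩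
  have hbn : b < n * s := (div_lt_iff₀ hs0).1 (hk.trans (by exact_mod_cast hn))
  calc (b : EReal) < (n : EReal) * s := by exact_mod_cast hbn
    _ ≤ n * a := mul_le_mul_of_nonneg_left hsa.le (by positivity)

theorem mainTheorem2 (E : Set ℝ) (hE : Bornology.IsBounded E) (hdim : 0 < upperMinkowskiDim E) :
    ∃ (n : ℕ) (T : (Fin n → ℝ) →ₗ[ℝ] ℝ),
      Dense (quotientSet (T '' {x : Fin n → ℝ | ∀ i, x i ∈ E})) := by
  have hpi : ∀ n, {x : Fin n → ℝ | ∀ i, x i ∈ E} = Set.univ.pi fun _ => E := by simp [Set.pi]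
  simp only [hpi]
  by_contra! hQ
  obtain ⟨k, hk⟩ := exists_forall_gt_lt_natCast_mul hdim 1
  obtain ⟨n, hkn, T, K, hT⟩ := exists_linearMap_antilipschitzWith_of_forall_not_dense hQ k
  have : Nonempty (Fin n) := ⟨⟨k, hkn⟩⟩
  have hbounded : Bornology.IsBounded (T '' Set.univ.pi fun _ => E) :=
    T.toContinuousLinearMap.lipschitz.isBounded_image (.pi fun _ => hE)
  have hle : n * upperMinkowskiDim E ≤ 1 :=
    calc n * upperMinkowskiDim E ≤ upperMinkowskiDim (Set.univ.pi fun _ : Fin n => E) := by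
          simpa using card_mul_upperMinkowskiDim_le_pi (ι := Fin n) E
      _ ≤ upperMinkowskiDim (T '' Set.univ.pi fun _ => E) :=
          upperMinkowskiDim_le_image_of_antilipschitzWith hT
      _ ≤ 1 := by simpa using upperMinkowskiDim_le_finrank hbounded
  exact (hk n hkn).not_ge hle
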